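/- Let $m,N\ge 1$ be integers and $h=1/N$. Let $E_k$ be the Euler–Frobenius polynomial of degree $k$, $E_k(\lambda)=\frac{(1-\lambda)^{k+2}}{\lambda}\left(\lambda\frac{d}{d\lambda}\right)^k\frac{\lambda}{(1-\lambda)^2}$. The polynomial $E_{2m-2}$ has exactly $m-1$ distinct complex roots $q_1,\dots,q_{m-1}$ with $|q_k|<1$, and $q_kE_{2m-1}(q_k)\ne0$. Define the discrete analogue of $d^{2m}/dx^{2m}$, for $\beta\in\mathbb Z$, by $$D_h^{(m)}[\beta]=\frac{(2m-1)!}{h^{2m}}\begin{cases}\displaystyle\sum_{k=1}^{m-1}\frac{(1-q_k)^{2m+1}q_k^{|\beta|}}{q_kE_{2m-1}(q_k)},&|\beta|\ge2,\\ \displaystyle 1+\sum_{k=1}^{m-1}\frac{(1-q_k)^{2m+1}}{E_{2m-1}(q_k)},&|\beta|=1,\\ \displaystyle -2^{2m-1}+\sum_{k=1}^{m-1}\frac{(1-q_k)^{2m+1}}{q_kE_{2m-1}(q_k)},&\beta=0,\end{cases}$$ and put $B_{2m}[\beta]=\sum_{\gamma\in\mathbb Z\setminus\{0\}}\frac{\exp(-2\pi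 i\gamma h\beta)}{(2\pi i\gamma)^{2m}}$ and $\Phi[\beta]=\sum_{\gamma\in\mathbb Z}\delta[\beta-\gamma h^{-1}]$, where $\delta[\beta-\gamma h^{-1}]$ is $1$ if $\beta=\gamma h^{-1}$ and $0$ otherwise. For functions on $\mathbb Z$ let $(f*g)[\beta]=\sum_{\gamma\in\mathbb Z}f[\gamma]g[\beta-\gamma]$. Then, with an absolutely convergent convolution, $$hD_h^{(m)}[\beta]*B_{2m}[\beta]=\Phi[\beta]-h\qquad(\beta\in\mathbb Z).$$ Moreover, let $\Gamma_h^{(m)}(p)=\Big[\frac{(-1)^m}{(2\pi)^{2m}}\sum_{\gamma\in\mathbb Z}\frac1{(p-h^{-1}\gamma)^{2m}}\Big]^{-1}$ for $p\in\mathbb R\setminus h^{-1}\mathbb Z$. The function $D_h^{(m)}$ is summable, and the Fourier transform (with kernel $e^{2\pi ipx}$) of the harrow-shaped distribution $\sum_\beta hD_h^{(m)}[\beta]\,\delta(x-h\beta)$ is the function $h\,\Gamma_h^{(m)}(p)$, as tempered distributions and also pointwise: $\sum_\beta D_h^{(m)}[\beta]e^{2\pi iph\beta}=\Gamma_h^{(m)}(p)$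 for all real $p\notin h^{-1}\mathbb Z$, and this sum is $0$ for $p\in h^{-1}\mathbb Z$. The two descriptions are equivalent in the following sense: a summable $f:\mathbb Z\to\mathbb C$ satisfies $hf*B_{2m}=\Phi-h$ if and only if, for every integer $p$, $\sum_\beta f[\beta]e^{2\pi iph\beta}$ equals $\Gamma_h^{(m)}(p)$ when $hp\notin\mathbb Z$ and $0$ when $hp\in\mathbb Z$. -/

import Mathlib

open scoped FourierTransform SchwartzMap

/-- The Euler–Frobenius polynomial `E_k` of degree `k`, i.e.
`E_k(x) = ((1 - x)^(k+2) / x) (x d/dx)^k [x / (1 - x)^2]`, so that `E_k(x) / (1 - x)^(k+2)` is the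
generating function of `(n + 1)^(k+1)`. Applying `x d/dx` once more gives the recurrence
`E_{k+1} = ((k + 1) x + 1) E_k + x (1 - x) E_k'` used here; thus `E_0 = 1`, `E_1 = x + 1`,
`E_2 = x^2 + 4 x + 1`, `E_3 = x^3 + 11 x^2 + 11 x + 1`. -/
noncomputable def eulerFrobenius : ℕ → Polynomial ℂ
  | 0 => 1
  | k + 1 =>
      (Polynomial.C ((k : ℂ) + 1) * Polynomial.X + 1) * eulerFrobenius k
        + Polynomial.X * (1 - Polynomial.X) * Polynomial.derivative (eulerFrobenius k)

/-- The roots `q_k` of `E_{2m-2}` with `|q_k| < 1`. -/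
noncomputable def innerRoots (m : ℕ) : Finset ℂ :=
  (eulerFrobenius (2 * m - 2)).roots.toFinset.filter (fun q => ‖q‖ < 1)

/-- The discrete analogue `D_h^{(m)}[β]` of `d^{2m}/dx^{2m}`. -/
noncomputable def discreteD (m : ℕ) (h : ℝ) (β : ℤ) : ℂ :=
  ((Nat.factorial (2 * m - 1) : ℂ) / (h : ℂ) ^ (2 * m)) *
    (if β = 0 then
      -(2 : ℂ) ^ (2 * m - 1)
        + ∑ q ∈ innerRoots m,
            (1 - q) ^ (2 * m + 1) / (q * (eulerFrobenius (2 * m - 1)).eval q)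
    else if β.natAbs = 1 then
      1 + ∑ q ∈ innerRoots m,
            (1 - q) ^ (2 * m + 1) / (eulerFrobenius (2 * m - 1)).eval q
    else
      ∑ q ∈ innerRoots m,
        (1 - q) ^ (2 * m + 1) * q ^ β.natAbs / (q * (eulerFrobenius (2 * m - 1)).eval q))

/-- The function `B_{2m}[β] = ∑_{γ ≠ 0} exp(-2πiγhβ) / (2πiγ)^{2m}` of discrete argument. -/
noncomputable def discreteB (m : ℕ) (h : ℝ) (β : ℤ) : ℂ :=
  ∑' γ : ℤ, if γ = 0 then 0 else
    Complex.exp (-2 * Real.pi * Complex.I * γ * h * β) / (2 * Real.pi * Complex.I * γ) ^ (2 * m)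

/-- The comb `Φ[β] = ∑_γ δ[β - γ h⁻¹]`. -/
noncomputable def discretePhi (h : ℝ) (β : ℤ) : ℂ :=
  ∑' γ : ℤ, if (β : ℝ) = (γ : ℝ) * h⁻¹ then 1 else 0

/-- The convolution `f[β] * g[β] = ∑_γ f[γ] g[β - γ]` of functions of discrete argument. -/
noncomputable def discreteConv (f g : ℤ → ℂ) (β : ℤ) : ℂ :=
  ∑' γ : ℤ, f γ * g (β - γ)

/-- `Γ_h^{(m)}(p) = [(-1)^m / (2π)^{2m} · ∑_γ 1 / (p - h⁻¹ γ)^{2m}]⁻¹`, meaningful for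
`p ∉ h⁻¹ ℤ`. -/
noncomputable def symbolGamma (m : ℕ) (h : ℝ) (p : ℝ) : ℝ :=
  ((-1) ^ m / (2 * Real.pi) ^ (2 * m) * ∑' γ : ℤ, 1 / (p - h⁻¹ * γ) ^ (2 * m))⁻¹

/-- `T` is the harrow-shaped distribution `∑_β h ψ[β] δ(x - hβ)` of `ψ`: the series converges to
the tempered distribution `T` on every Schwartz function. This determines `T`. -/
def IsHarrow (h : ℝ) (ψ : ℤ → ℂ) (T : 𝓢'(ℝ, ℂ)) : Prop :=
  ∀ φ : 𝓢(ℝ, ℂ), HasSum (fun β : ℤ => (h : ℂ) * ψ β * φ (h * β)) (T φ)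

/-- The tempered distribution `T` is given by integration against the function `g`. -/
def IsGivenBy (T : 𝓢'(ℝ, ℂ)) (g : ℝ → ℂ) : Prop :=
  ∀ φ : 𝓢(ℝ, ℂ), MeasureTheory.Integrable (fun p => φ p * g p) ∧ T φ = ∫ p, φ p * g p

/-- The Fourier transform, with kernel `exp(2πipx)`, of the harrow-shaped distribution
`∑_β h ψ[β] δ(x - hβ)`, as the function `∑_β h ψ[β] exp(2πiphβ)` of `p`, for summable `ψ`. -/
noncomputable def harrowFourier (h : ℝ) (ψ : ℤ → ℂ) (p : ℝ) : ℂ :=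
  ∑' β : ℤ, (h : ℂ) * ψ β * Complex.exp (2 * Real.pi * Complex.I * p * h * β)

/-!
The Fourier series of `D_h^{(m)}` is a rational function of `z = exp (2πihp)`, namely
`(2m-1)! / h^(2m) * (1 - z)^(2m) / (z E_{2m-2}(z))`, and its reciprocal is the periodised power
that occurs in `Γ_h^{(m)}`.

*Roots.* In the variable `t = z / (1 - z)` the function `z E_k(z) / (1 - z)^(k+2)` becomes a real
polynomial `P_{k+1}(t)`, with `P_{k+1} = t (t + 1) P_k'` (`eulerFrobenius.mul_eval_eq`). Rolle's
theorem then shows by induction that all roots of `E_k` are simple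
(`eulerFrobenius.card_roots_toFinset`), and the symmetry `t ↦ -1 - t` of `P_{k+1}` is the
reciprocity `z^k E_k(1/z) = E_k(z)`. Lipschitz's formula
`∑_n (x + n)^(-2m) = (2πi)^(2m) / (2m-1)! * z E_{2m-2}(z) / (1 - z)^(2m)`, `z = exp (2πix)`, for
real `x ∉ ℤ` comes from the derivatives of `π cot (πx)` in the upper half plane by passage to the
boundary. Its left side is positive, so `E_{2m-2}` has no root on the unit circle and its `2m - 2`
roots split into pairs `q, q⁻¹` with `|q| < 1` (`card_innerRoots`).

*Symbol.* Partial fractions of `(1 - z)^(2m) / (z E_{2m-2}(z))` over these pairs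
(`symbol_eq_sum_innerRoots`), expanded into geometric series on the unit circle, have exactly the
coefficients of `D_h^{(m)}` (`hasSum_discreteD_mul_zpow`). With Lipschitz's formula this gives the
pointwise statement, and integrating the series term by term gives the distributional one.

*Convolution.* Inserting the Fourier series of `B_{2m}` into `h f * B_{2m}` and grouping the
frequencies modulo `N` yields a discrete Fourier expansion with coefficients `F(r) W(r)`, where `F`
is the Fourier series of `f` and `W(r) = 1 / Γ_h^{(m)}(r)` is a periodised weight, nonzero also for
`r = 0`. Since `Φ - h` has the coefficients `h` for `r ≠ 0` and `0` for `r = 0`, uniqueness of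
discrete Fourier coefficients gives the equivalence (`discreteConv_eq_iff_symbolGamma`); the
convolution identity for `D_h^{(m)}` is the special case `f = D_h^{(m)}`.
-/

/-! ### Polynomials in `z / (1 - z)` and the roots of `E_k` -/

open Polynomial in
/-- The polynomial `P_k` over `ℝ` with `∑_{n ≥ 1} n ^ k z ^ n = P_k (z / (1 - z))`. In the variable
`t = z / (1 - z)` the operator `z d/dz` becomes `t (t + 1) d/dt`. -/
noncomputable def geomPoly : ℕ → ℝ[X]
  | 0 => X
  | k + 1 => X * (X + 1) * derivative (geomPoly k)

namespace geomPoly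

open Polynomial

theorem ne_zero (k : ℕ) : geomPoly k ≠ 0 := by
  have h : ∀ k, (geomPoly k).eval 0 = 0 ∧ (derivative (geomPoly k)).eval 0 = 1 := by
    intro k
    induction k with
    | zero => simp [geomPoly]
    | succ k ih => simp [geomPoly, ih.2]
  intro h0
  have := (h k).2
  simp [h0] at this

/-- `P_{k+1}` has at least `k + 2` distinct real roots: `0` and `-1`, and by Rolle's theorem, if
`k ≥ 1`, one between any two neighbouring roots of `P_k`. -/
theorem card_le_card_roots (k : ℕ) : k + 2 ≤ (geomPoly (k + 1)).roots.toFinset.card := by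
  have hroots : ∀ k, (geomPoly (k + 1)).roots.toFinset =
      insert 0 (insert (-1) (derivative (geomPoly k)).roots.toFinset) := by
    intro k
    have h := ne_zero (k + 1)
    have hd : derivative (geomPoly k) ≠ 0 := by
      intro h0
      simp [geomPoly, h0] at h
    ext x
    simp only [Multiset.mem_toFinset, mem_roots h, mem_roots hd, Finset.mem_insert, IsRoot.def]
    simp [geomPoly, or_assoc, add_eq_zero_iff_eq_neg]
  induction k with
  | zero =>
    rw [hroots]
    simp [geomPoly]
  | succ k ih =>
    have hrolle := card_roots_toFinset_le_card_roots_derivative_sdiff_roots_succ (geomPoly (k + 1))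
    have hsub : insert 0 (insert (-1) ((derivative (geomPoly (k + 1))).roots.toFinset \
        (geomPoly (k + 1)).roots.toFinset)) ⊆ (geomPoly (k + 1 + 1)).roots.toFinset := by
      rw [hroots (k + 1)]
      gcongr
      exact Finset.sdiff_subset
    have hcard := Finset.card_le_card hsub
    rw [Finset.card_insert_of_notMem, Finset.card_insert_of_notMem] at hcard
    · omega
    · simp [hroots k]
    · simp [hroots k]

/-- The substitution `z ↦ z⁻¹` is `t ↦ -1 - t` in the variable `t = z / (1 - z)`. -/
theorem comp_neg_one_sub (k : ℕ) :
    (geomPoly (k + 1)).comp (-1 - X) = (-1) ^ k * geomPoly (k + 1) := by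
  induction k with
  | zero => simp [geomPoly]; ring
  | succ k ih =>
    have h := congrArg derivative ih
    rw [derivative_comp] at h
    have h1 : derivative ((-1 : ℝ[X]) ^ k * geomPoly (k + 1)) =
        (-1) ^ k * derivative (geomPoly (k + 1)) := by
      have : ((-1 : ℝ[X]) ^ k) = C ((-1) ^ k) := by simp
      rw [this, derivative_C_mul]
    rw [h1] at h
    simp only [derivative_sub, derivative_neg, derivative_one, derivative_X] at h
    rw [geomPoly]
    simp only [mul_comp, add_comp, X_comp, one_comp]
    linear_combination -((-1 - X) * (-1 - X + 1)) * h

theorem aeval_neg_one_sub (k : ℕ) (t : ℂ) :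
    aeval (-1 - t) (geomPoly (k + 1)) = (-1) ^ k * aeval t (geomPoly (k + 1)) := by
  have := congrArg (aeval t) (comp_neg_one_sub k)
  simpa [aeval_comp] using this

end geomPoly

namespace eulerFrobenius

open Polynomial

theorem coeff_succ_succ (k j : ℕ) : (eulerFrobenius (k + 1)).coeff (j + 1) =
    (k + 1 - j) * (eulerFrobenius k).coeff j + (j + 2) * (eulerFrobenius k).coeff (j + 1) := by
  have h1 : eulerFrobenius (k + 1) = C ((k : ℂ) + 1) * (eulerFrobenius k * X) + eulerFrobenius k
      + derivative (eulerFrobenius k) * X - derivative (eulerFrobenius k) * X * X := by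
    rw [eulerFrobenius]; ring
  rw [h1]
  simp only [coeff_add, coeff_sub, coeff_C_mul, coeff_mul_X]
  rcases j with _ | j
  · simp [coeff_derivative]; ring
  · simp [coeff_derivative]; ring

theorem coeff_zero (k : ℕ) : (eulerFrobenius k).coeff 0 = 1 := by
  induction k with
  | zero => simp [eulerFrobenius]
  | succ k ih =>
    rw [coeff_zero_eq_eval_zero] at ih ⊢
    simp [eulerFrobenius, ih]

theorem coeff_of_lt {k j : ℕ} (h : k < j) : (eulerFrobenius k).coeff j = 0 := by
  induction k generalizing j with
  | zero => simp [eulerFrobenius, coeff_one, h.ne']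
  | succ k ih =>
    obtain ⟨i, rfl⟩ : ∃ i, j = i + 1 := ⟨j - 1, by omega⟩
    rw [coeff_succ_succ, ih (by omega), ih (by omega)]
    simp

theorem coeff_self (k : ℕ) : (eulerFrobenius k).coeff k = 1 := by
  induction k with
  | zero => simp [eulerFrobenius]
  | succ k ih => rw [coeff_succ_succ, ih, coeff_of_lt (Nat.lt_succ_self k)]; simp

/-- The subleading coefficient of `E_{k+1}`, an Eulerian number. -/
theorem coeff_succ_self (k : ℕ) : (eulerFrobenius (k + 1)).coeff k = 2 ^ (k + 2) - k - 3 := by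
  induction k with
  | zero => rw [coeff_zero]; norm_num
  | succ k ih =>
    rw [coeff_succ_succ, ih, coeff_self]
    push_cast
    ring

theorem natDegree_eq (k : ℕ) : (eulerFrobenius k).natDegree = k :=
  le_antisymm (natDegree_le_iff_coeff_eq_zero.2 fun _ h => coeff_of_lt h)
    (le_natDegree_of_ne_zero (by simp [coeff_self]))

theorem monic (k : ℕ) : (eulerFrobenius k).Monic := by
  rw [Monic, leadingCoeff, natDegree_eq, coeff_self]

theorem eval_zero (k : ℕ) : (eulerFrobenius k).eval 0 = 1 := by
  rw [← coeff_zero_eq_eval_zero, coeff_zero]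

theorem eval_one (k : ℕ) : (eulerFrobenius k).eval 1 = ((k + 1).factorial : ℂ) := by
  induction k with
  | zero => simp [eulerFrobenius]
  | succ k ih =>
    simp only [eulerFrobenius, eval_add, eval_mul, eval_C, eval_X, Polynomial.eval_one, ih,
      eval_sub, sub_self,
      mul_zero, zero_mul, add_zero, Nat.factorial_succ (k + 1)]
    push_cast
    ring

/-- `z E_k(z) / (1 - z)^(k+2)` is the polynomial `P_{k+1}` in `z / (1 - z)`; both are
`∑ n ^ (k + 1) z ^ n` for `|z| < 1`. -/
theorem mul_eval_eq (k : ℕ) {z : ℂ} (hz : z ≠ 1) : z * (eulerFrobenius k).eval z =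
    (1 - z) ^ (k + 2) * aeval (z / (1 - z)) (geomPoly (k + 1)) := by
  have ht : ∀ z : ℂ, z ≠ 1 → HasDerivAt (fun z : ℂ => z / (1 - z)) (1 / (1 - z) ^ 2) z := by
    intro z hz
    have h1 : (1 - z) ≠ 0 := sub_ne_zero.2 hz.symm
    convert! (hasDerivAt_id' z).fun_div ((hasDerivAt_id' z).const_sub 1) h1 using 1
    ring
  induction k generalizing z with
  | zero =>
    have h1 : (1 - z) ≠ 0 := sub_ne_zero.2 hz.symm
    simp [eulerFrobenius, geomPoly]
    field_simp
    ring
  | succ k ih =>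
    have h1 : (1 - z) ≠ 0 := sub_ne_zero.2 hz.symm
    have hl : HasDerivAt (fun z : ℂ => z * (eulerFrobenius k).eval z)
        (1 * (eulerFrobenius k).eval z + z * (derivative (eulerFrobenius k)).eval z) z :=
      (hasDerivAt_id z).mul ((eulerFrobenius k).hasDerivAt z)
    have hp : HasDerivAt (fun z : ℂ => (1 - z) ^ (k + 2)) (((k + 2 : ℕ) : ℂ) * (1 - z) ^ (k + 1)
        * (-1)) z := by
      simpa using ((hasDerivAt_id' z).const_sub 1).fun_pow (k + 2)
    have hr := hp.mul (((geomPoly (k + 1)).hasDerivAt_aeval (z / (1 - z))).comp z (ht z hz))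
    have hev : ∀ᶠ w in nhds z, w ≠ 1 := isOpen_ne.mem_nhds hz
    have heq := (hl.congr_of_eventuallyEq (hev.mono fun w hw => (ih hw).symm)).unique hr
    have hk := ih hz
    simp only [Function.comp_def] at heq
    rw [geomPoly]
    simp only [map_mul, map_add, aeval_X, map_one, eulerFrobenius, eval_add, eval_mul, eval_C,
      eval_X, Polynomial.eval_one, eval_sub]
    have h2 : (1 - z) ^ (k + 2) * (1 / (1 - z) ^ 2) = (1 - z) ^ k := by
      field_simp
      ring
    have h3 : (1 - z) ^ (k + 1 + 2) * (z / (1 - z) * (z / (1 - z) + 1)) =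
        z * (1 - z) ^ (k + 1) := by
      field_simp
      ring
    rw [← mul_assoc, h3]
    push_cast at heq
    linear_combination (z * (1 - z)) * heq + z * (k + 2) * hk + z * (1 - z) *
      (aeval (z / (1 - z)) (derivative (geomPoly (k + 1)))) * h2

/-- Reciprocity of the Euler–Frobenius polynomials: their coefficients are palindromic. -/
theorem pow_mul_eval_inv (k : ℕ) {z : ℂ} (hz : z ≠ 0) :
    z ^ k * (eulerFrobenius k).eval z⁻¹ = (eulerFrobenius k).eval z := by
  rcases eq_or_ne z 1 with rfl | h1
  · simp
  have h2 : (1 - z) ≠ 0 := sub_ne_zero.2 h1.symm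
  have h3 : z⁻¹ ≠ 1 := by simpa using h1
  have ha := mul_eval_eq k h1
  have hb := mul_eval_eq k h3
  have ht : z⁻¹ / (1 - z⁻¹) = -1 - z / (1 - z) := by
    have : z - 1 ≠ 0 := sub_ne_zero.2 h1
    field_simp
    ring
  have hc : (1 - z⁻¹) ^ (k + 2) = (-1) ^ k * (1 - z) ^ (k + 2) / z ^ (k + 2) := by
    have : 1 - z⁻¹ = (-1) * (1 - z) / z := by field_simp; ring
    rw [this, div_pow, mul_pow]
    ring
  rw [ht, geomPoly.aeval_neg_one_sub, hc] at hb
  have hs : ((-1 : ℂ) ^ k) * (-1) ^ k = 1 := by rw [← mul_pow]; simp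
  have : z * (z ^ k * (eulerFrobenius k).eval z⁻¹) = z * (eulerFrobenius k).eval z := by
    rw [ha]
    have hb' : (eulerFrobenius k).eval z⁻¹ = z * ((-1) ^ k * (1 - z) ^ (k + 2) / z ^ (k + 2) *
      ((-1) ^ k * (aeval (z / (1 - z))) (geomPoly (k + 1)))) := by
      rw [← hb]; field_simp
    rw [hb']
    have hq : z * (z ^ k * z) * (z ^ (k + 2))⁻¹ = 1 := by
      field_simp
      ring
    linear_combination ((1 - z) ^ (k + 2) * (aeval (z / (1 - z))) (geomPoly (k + 1))) *
      ((-1) ^ k * (-1) ^ k * hq + hs)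
  exact mul_left_cancel₀ hz this

/-- `E_k` has `k` distinct roots: they are the points `t / (1 + t)`, where `t` runs over the real
roots of `P_{k+1}` other than `0` and `-1`. -/
theorem card_roots_toFinset (k : ℕ) : (eulerFrobenius k).roots.toFinset.card = k := by
  apply le_antisymm
  · exact (Multiset.toFinset_card_le _).trans ((card_roots' _).trans (natDegree_eq k).le)
  -- Neither `0` nor `-1` gives a root of `E_k`: at `t = 0` the factor `z` vanishes, and `t = -1`
  -- corresponds to `z = ∞`.
  let S := ((geomPoly (k + 1)).roots.toFinset.erase 0).erase (-1)
  have hS : k ≤ S.card := by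
    have h0 := geomPoly.card_le_card_roots k
    have h1 := Finset.pred_card_le_card_erase (s := (geomPoly (k + 1)).roots.toFinset) (a := 0)
    have h2 := Finset.pred_card_le_card_erase
      (s := (geomPoly (k + 1)).roots.toFinset.erase 0) (a := -1)
    change k ≤ (((geomPoly (k + 1)).roots.toFinset.erase 0).erase (-1)).card
    omega
  refine hS.trans (Finset.card_le_card_of_injOn (fun t : ℝ => (t : ℂ) / (1 + t)) ?_ ?_)
  · intro t ht
    simp only [S, Finset.coe_erase, Set.mem_sdiff, Finset.mem_coe, Multiset.mem_toFinset,
      Set.mem_singleton_iff, mem_roots (geomPoly.ne_zero _)] at ht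
    obtain ⟨⟨hroot, h0⟩, h1⟩ := ht
    have h0' : (t : ℂ) ≠ 0 := by exact_mod_cast h0
    have h1' : (1 + t : ℂ) ≠ 0 := by
      have : 1 + t ≠ 0 := fun h => h1 (by linarith)
      exact_mod_cast this
    have hz1 : (t : ℂ) / (1 + t) ≠ 1 := by
      intro h
      rw [div_eq_one_iff_eq h1'] at h
      simp at h
    have hz := mul_eval_eq k hz1
    have ht' : (t : ℂ) / (1 + t) / (1 - t / (1 + t)) = (t : ℝ) := by
      field_simp
      simp
    have hr : aeval (t : ℂ) (geomPoly (k + 1)) = 0 := by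
      have := aeval_algebraMap_apply_eq_algebraMap_eval (A := ℂ) t (geomPoly (k + 1))
      rw [hroot] at this
      simpa using this
    rw [ht', hr, mul_zero] at hz
    simp only [Finset.mem_coe, Multiset.mem_toFinset, mem_roots (monic k).ne_zero]
    exact (mul_eq_zero.1 hz).resolve_left (div_ne_zero h0' h1')
  · intro s hs t ht hst
    have hne : ∀ t ∈ (S : Set ℝ), (1 + t : ℂ) ≠ 0 := by
      intro t ht
      have h1 : t ≠ -1 := by
        intro h
        simp [S, h] at ht
      have : 1 + t ≠ 0 := fun h => h1 (by linarith)
      exact_mod_cast this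
    have h1 := hne s hs
    have h2 := hne t ht
    simp only at hst
    rw [div_eq_div_iff h1 h2] at hst
    have : (s : ℂ) = t := by linear_combination hst
    exact_mod_cast this

end eulerFrobenius

/-! ### Lipschitz's formula on the real line -/

section Lipschitz

open Complex Polynomial
open UpperHalfPlane (upperHalfPlaneSet isOpen_upperHalfPlaneSet)

theorem exp_two_pi_I_mul_ne_one {z : ℂ} (hz : ∀ n : ℤ, z ≠ n) :
    exp (2 * Real.pi * I * z) ≠ 1 := by
  intro h
  obtain ⟨n, hn⟩ := exp_eq_one_iff.1 h
  refine hz n (mul_left_cancel₀ two_pi_I_ne_zero ?_)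
  rw [hn]
  ring

/-- The iterated derivatives of `π cot (π z)` are polynomials in `q / (1 - q)`, `q = exp (2πiz)`. -/
theorem iteratedDerivWithin_cot_pi_mul_eq_aeval_geomPoly (k : ℕ) {z : ℂ}
    (hz : z ∈ upperHalfPlaneSet) :
    iteratedDerivWithin (k + 1) (fun x : ℂ => Real.pi * cot (Real.pi * x)) upperHalfPlaneSet z =
      -(2 * Real.pi * I) ^ (k + 2) * aeval (exp (2 * Real.pi * I * z) /
        (1 - exp (2 * Real.pi * I * z))) (geomPoly (k + 1)) := by
  have hne : ∀ z ∈ upperHalfPlaneSet, 1 - exp (2 * Real.pi * I * z) ≠ 0 := fun z hz =>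
    sub_ne_zero.2 (exp_two_pi_I_mul_ne_one fun n => UpperHalfPlane.ne_intCast ⟨z, hz⟩ n).symm
  have hderiv : ∀ (k : ℕ), ∀ z ∈ upperHalfPlaneSet,
      HasDerivAt (fun z => aeval (exp (2 * Real.pi * I * z) /
        (1 - exp (2 * Real.pi * I * z))) (geomPoly k))
        (2 * Real.pi * I * aeval (exp (2 * Real.pi * I * z) /
        (1 - exp (2 * Real.pi * I * z))) (geomPoly (k + 1))) z := by
    intro k z hz
    have h1 := hne z hz
    have he : HasDerivAt (fun z : ℂ => exp (2 * Real.pi * I * z))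
        (exp (2 * Real.pi * I * z) * (2 * Real.pi * I)) z := by
      simpa using ((hasDerivAt_id' z).const_mul (2 * Real.pi * I)).cexp
    have ht := he.fun_div (he.const_sub 1) h1
    convert! ((geomPoly k).hasDerivAt_aeval _).comp z ht using 1
    simp only [geomPoly, map_mul, map_add, aeval_X, map_one]
    field_simp
    ring
  induction k generalizing z with
  | zero =>
    have hcot : Set.EqOn (fun x : ℂ => Real.pi * cot (Real.pi * x))
        (fun z => -(Real.pi * I) - 2 * Real.pi * I * aeval (exp (2 * Real.pi * I * z) /
        (1 - exp (2 * Real.pi * I * z))) (geomPoly 0)) upperHalfPlaneSet := by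
      intro z hz
      have h1 := hne z hz
      simp only [cot_pi_eq_exp_ratio, geomPoly, aeval_X]
      rw [div_mul_eq_div_div, div_I]
      generalize exp (2 * Real.pi * I * z) = q at h1 ⊢
      field_simp
      ring
    rw [zero_add, iteratedDerivWithin_one, derivWithin_congr hcot (hcot hz),
      derivWithin_of_isOpen isOpen_upperHalfPlaneSet hz,
      (((hderiv 0 z hz).const_mul _).const_sub _).deriv]
    ring
  | succ k ih =>
    rw [iteratedDerivWithin_succ, derivWithin_congr (fun w hw => ih hw) (ih hz),
      derivWithin_of_isOpen isOpen_upperHalfPlaneSet hz, ((hderiv (k + 1) z hz).const_mul _).deriv]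
    ring

/-- Lipschitz's formula at real points. It is classical in the upper half plane, from where both
sides extend continuously to `ℝ ∖ ℤ`. -/
theorem tsum_one_div_add_int_pow {x : ℝ} (hx : ∀ n : ℤ, x ≠ n) (k : ℕ) :
    ∑' n : ℤ, 1 / ((x : ℂ) + n) ^ (k + 2) = (-1) ^ k * (2 * Real.pi * I) ^ (k + 2) /
      (k + 1).factorial * aeval (exp (2 * Real.pi * I * x) / (1 - exp (2 * Real.pi * I * x)))
        (geomPoly (k + 1)) := by
  have hup : ∀ z ∈ upperHalfPlaneSet, ∑' n : ℤ, 1 / (z + n) ^ (k + 2) =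
      (-1) ^ k * (2 * Real.pi * I) ^ (k + 2) / (k + 1).factorial *
      aeval (exp (2 * Real.pi * I * z) / (1 - exp (2 * Real.pi * I * z))) (geomPoly (k + 1)) := by
    intro z hz
    have h1 := iteratedDerivWithin_cot_pi_mul_eq_mul_tsum_div_pow (k := k + 1) (by omega) hz
    rw [iteratedDerivWithin_cot_pi_mul_eq_aeval_geomPoly k hz] at h1
    have hf : ((k + 1).factorial : ℂ) ≠ 0 := by exact_mod_cast (k + 1).factorial_ne_zero
    have hs : ((-1 : ℂ) ^ k) * (-1) ^ k = 1 := by rw [← mul_pow]; simp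
    rw [div_mul_eq_mul_div, eq_div_iff hf]
    linear_combination ((-1) ^ k) * h1 - (k + 1).factorial *
      (∑' n : ℤ, 1 / (z + n) ^ (k + 2)) * hs
  let path : ℝ → ℂ := fun ε => x + ε * I
  have hpath : Filter.Tendsto path (nhdsWithin 0 (Set.Ioi 0)) (nhds (x : ℂ)) := by
    have : Continuous path := by fun_prop
    simpa [path] using (this.tendsto 0).mono_left nhdsWithin_le_nhds
  have hmem : ∀ ε ∈ Set.Ioi (0 : ℝ), path ε ∈ upperHalfPlaneSet := by
    intro ε hε
    simpa [path, upperHalfPlaneSet] using hε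
  have hxz : ∀ n : ℤ, (x : ℂ) ≠ n := fun n h => hx n (by exact_mod_cast h)
  have hxn : ∀ n : ℤ, (x : ℂ) + n ≠ 0 := by
    intro n h
    exact hxz (-n) (by push_cast; linear_combination h)
  have hne : 1 - exp (2 * Real.pi * I * x) ≠ 0 := sub_ne_zero.2 (exp_two_pi_I_mul_ne_one hxz).symm
  -- The terms on the path towards `x` are dominated by those at `x`, as `|Re w| ≤ |w|`.
  have hleft : Filter.Tendsto (fun ε => ∑' n : ℤ, 1 / (path ε + n) ^ (k + 2))
      (nhdsWithin 0 (Set.Ioi 0)) (nhds (∑' n : ℤ, 1 / ((x : ℂ) + n) ^ (k + 2))) := by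
    have hsum : Summable fun n : ℤ => ‖1 / ((x : ℂ) + n) ^ (k + 2)‖ := by
      have := (EisensteinSeries.linear_right_summable (x : ℂ) 1 (k := (k + 2 : ℕ)) (by omega)).norm
      refine this.congr fun n => ?_
      rw [zpow_natCast]
      simp
    refine tendsto_tsum_of_dominated_convergence hsum ?_ ?_
    · intro n
      have : ContinuousAt (fun z : ℂ => 1 / (z + n) ^ (k + 2)) x := by
        have := hxn n
        fun_prop (disch := positivity)
      exact this.tendsto.comp hpath
    · refine Filter.Eventually.of_forall fun ε n => ?_
      simp only [norm_div, norm_pow, norm_one]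
      have hpos : 0 < ‖(x : ℂ) + n‖ := norm_pos_iff.2 (hxn n)
      gcongr
      have h1 : (x : ℂ) + n = ((x + n : ℝ) : ℂ) := by push_cast; ring
      calc ‖(x : ℂ) + n‖ = |(path ε + n).re| := by rw [h1, norm_real]; simp [path]
        _ ≤ ‖path ε + n‖ := abs_re_le_norm _
  have hright : ContinuousAt (fun z : ℂ => (-1) ^ k * (2 * Real.pi * I) ^ (k + 2) /
      (k + 1).factorial * aeval (exp (2 * Real.pi * I * z) / (1 - exp (2 * Real.pi * I * z)))
        (geomPoly (k + 1))) x := by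
    have h1 : ContinuousAt (fun z : ℂ => exp (2 * Real.pi * I * z) /
        (1 - exp (2 * Real.pi * I * z))) x := by
      fun_prop (disch := assumption)
    refine ContinuousAt.mul (by fun_prop) ?_
    exact ((geomPoly (k + 1)).continuous_aeval.continuousAt).comp h1
  refine tendsto_nhds_unique (hleft.congr' ?_) (hright.tendsto.comp hpath)
  filter_upwards [self_mem_nhdsWithin] with ε hε
  exact hup _ (hmem ε hε)

/-- Lipschitz's formula in even order, in terms of the Euler–Frobenius polynomial. -/
theorem tsum_one_div_add_int_pow_eq_eulerFrobenius {x : ℝ} (hx : ∀ n : ℤ, x ≠ n) {m : ℕ}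
    (hm : 1 ≤ m) :
    ∑' n : ℤ, 1 / ((x : ℂ) + n) ^ (2 * m) =
      (2 * Real.pi * I) ^ (2 * m) / (2 * m - 1).factorial *
        (exp (2 * Real.pi * I * x) * (eulerFrobenius (2 * m - 2)).eval (exp (2 * Real.pi * I * x)) /
          (1 - exp (2 * Real.pi * I * x)) ^ (2 * m)) := by
  obtain ⟨n, rfl⟩ : ∃ n, m = n + 1 := ⟨m - 1, by omega⟩
  have hne := exp_two_pi_I_mul_ne_one (z := x) fun n h => hx n (by exact_mod_cast h)
  have h1 := sub_ne_zero.2 hne.symm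
  have h2 := tsum_one_div_add_int_pow hx (2 * n)
  rw [pow_mul (-1 : ℂ) 2 n, neg_one_sq, one_pow, one_mul] at h2
  rw [show 2 * (n + 1) - 2 = 2 * n by omega, show 2 * (n + 1) - 1 = 2 * n + 1 by omega,
    eulerFrobenius.mul_eval_eq _ hne, show 2 * (n + 1) = 2 * n + 2 by ring, h2,
    mul_div_cancel_left₀ _ (pow_ne_zero _ h1)]

/-- Periodised negative even powers converge and are positive. -/
theorem tsum_one_div_add_int_pow_pos {x : ℝ} (hx : ∀ n : ℤ, x ≠ n) {m : ℕ} (hm : 1 ≤ m) :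
    (Summable fun n : ℤ => 1 / (x + n) ^ (2 * m)) ∧ 0 < ∑' n : ℤ, 1 / (x + n) ^ (2 * m) := by
  have hs : Summable fun n : ℤ => 1 / (x + n) ^ (2 * m) := by
    have := EisensteinSeries.linear_right_summable (x : ℂ) 1 (k := (2 * m : ℕ)) (by omega)
    rw [← summable_ofReal]
    refine this.congr fun n => ?_
    rw [zpow_natCast]
    simp
  refine ⟨hs, hs.tsum_pos (fun n => ?_) 0 ?_⟩
  · exact div_nonneg zero_le_one ((even_two_mul m).pow_nonneg _)
  · have := (even_two_mul m).pow_pos (show x ≠ 0 by simpa using hx 0)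
    simpa using this

/-- `E_{2m-2}` has no zeros on the unit circle, where it is a multiple of a sum of
positive terms by Lipschitz's formula. -/
theorem eulerFrobenius.eval_ne_zero_of_norm_eq_one {m : ℕ} (hm : 1 ≤ m) {z : ℂ} (hz : ‖z‖ = 1) :
    (eulerFrobenius (2 * m - 2)).eval z ≠ 0 := by
  rcases eq_or_ne z 1 with rfl | h1
  · rw [eulerFrobenius.eval_one]
    exact_mod_cast Nat.factorial_ne_zero _
  obtain ⟨θ, rfl⟩ := (norm_eq_one_iff z).1 hz
  let x : ℝ := θ / (2 * Real.pi)
  have hθ : (2 * Real.pi * I * x : ℂ) = θ * I := by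
    have : (Real.pi : ℂ) ≠ 0 := by exact_mod_cast Real.pi_ne_zero
    simp only [x]
    push_cast
    field_simp
  rw [← hθ] at h1 ⊢
  have hx : ∀ n : ℤ, x ≠ n := by
    intro n h
    apply h1
    rw [h]
    exact exp_eq_one_iff.2 ⟨n, by push_cast; ring⟩
  intro h0
  have h2 := tsum_one_div_add_int_pow_eq_eulerFrobenius hx hm
  rw [h0] at h2
  have h3 : ((∑' n : ℤ, 1 / (x + n) ^ (2 * m) : ℝ) : ℂ) = 0 := by
    push_cast
    simpa using h2
  exact (tsum_one_div_add_int_pow_pos hx hm).2.ne' (by exact_mod_cast h3)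

end Lipschitz

/-! ### Roots of `E_{2m-2}` and partial fractions -/

section PartialFractions

open Polynomial

namespace eulerFrobenius

theorem ne_zero_of_eval_eq_zero {k : ℕ} {r : ℂ} (hr : (eulerFrobenius k).eval r = 0) : r ≠ 0 := by
  rintro rfl
  simp [eval_zero] at hr

theorem ne_one_of_eval_eq_zero {k : ℕ} {r : ℂ} (hr : (eulerFrobenius k).eval r = 0) : r ≠ 1 := by
  rintro rfl
  rw [eval_one] at hr
  exact Nat.factorial_ne_zero _ (by exact_mod_cast hr)

theorem eval_inv_eq_zero {k : ℕ} {r : ℂ} (hr : (eulerFrobenius k).eval r = 0) :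
    (eulerFrobenius k).eval r⁻¹ = 0 := by
  have h0 := ne_zero_of_eval_eq_zero hr
  have h1 := pow_mul_eval_inv k h0
  rw [hr] at h1
  exact (mul_eq_zero.1 h1).resolve_left (pow_ne_zero _ h0)

theorem mem_roots_toFinset {k : ℕ} {r : ℂ} :
    r ∈ (eulerFrobenius k).roots.toFinset ↔ (eulerFrobenius k).eval r = 0 := by
  rw [Multiset.mem_toFinset, mem_roots (monic k).ne_zero, IsRoot.def]

/-- Having `k` distinct roots, the monic polynomial `E_k` is their nodal polynomial. -/
theorem eq_nodal (k : ℕ) :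
    eulerFrobenius k = Lagrange.nodal (eulerFrobenius k).roots.toFinset id := by
  have h1 : (eulerFrobenius k).roots.card = (eulerFrobenius k).natDegree := by
    refine le_antisymm (card_roots' _) ?_
    calc (eulerFrobenius k).natDegree = (eulerFrobenius k).roots.toFinset.card := by
          rw [natDegree_eq, card_roots_toFinset]
      _ ≤ _ := Multiset.toFinset_card_le _
  have h2 : (eulerFrobenius k).roots.Nodup := by
    rw [← Multiset.toFinset_card_eq_card_iff_nodup, card_roots_toFinset, h1, natDegree_eq]
  have h3 := prod_multiset_X_sub_C_of_monic_of_roots_card_eq (monic k) h1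
  rw [Lagrange.nodal_eq, Finset.prod_eq_multiset_prod, Multiset.toFinset_val, h2.dedup]
  exact h3.symm

theorem eval_derivative_ne_zero {k : ℕ} {r : ℂ} (hr : (eulerFrobenius k).eval r = 0) :
    (derivative (eulerFrobenius k)).eval r ≠ 0 := by
  have hmem := mem_roots_toFinset.2 hr
  rw [eq_nodal k, ← id_eq r, Lagrange.eval_nodal_derivative_eval_node_eq hmem, Lagrange.eval_nodal,
    Finset.prod_ne_zero_iff]
  intro s hs
  exact sub_ne_zero.2 (Finset.ne_of_mem_erase hs).symm

theorem eval_succ_of_eval_eq_zero {k : ℕ} {r : ℂ} (hr : (eulerFrobenius k).eval r = 0) :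
    (eulerFrobenius (k + 1)).eval r = r * (1 - r) * (derivative (eulerFrobenius k)).eval r := by
  simp [eulerFrobenius, hr]

/-- Consecutive Euler–Frobenius polynomials have no common root, because the roots are simple. -/
theorem eval_succ_ne_zero {k : ℕ} {r : ℂ} (hr : (eulerFrobenius k).eval r = 0) :
    (eulerFrobenius (k + 1)).eval r ≠ 0 := by
  rw [eval_succ_of_eval_eq_zero hr]
  exact mul_ne_zero (mul_ne_zero (ne_zero_of_eval_eq_zero hr)
    (sub_ne_zero.2 (ne_one_of_eval_eq_zero hr).symm)) (eval_derivative_ne_zero hr)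

end eulerFrobenius

theorem mem_innerRoots {m : ℕ} {q : ℂ} :
    q ∈ innerRoots m ↔ (eulerFrobenius (2 * m - 2)).eval q = 0 ∧ ‖q‖ < 1 := by
  rw [innerRoots, Finset.mem_filter, eulerFrobenius.mem_roots_toFinset]

/-- The roots of `E_{2m-2}` come in pairs `q, q⁻¹` with `|q| < 1`. -/
theorem sum_roots_eq_sum_innerRoots {M : Type*} [AddCommMonoid M] {m : ℕ} (hm : 1 ≤ m)
    (g : ℂ → M) :
    ∑ r ∈ (eulerFrobenius (2 * m - 2)).roots.toFinset, g r =
      ∑ q ∈ innerRoots m, (g q + g q⁻¹) := by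
  rw [Finset.sum_add_distrib,
    ← Finset.sum_filter_add_sum_filter_not _ (fun q : ℂ => ‖q‖ < 1)]
  congr 1
  symm
  refine Finset.sum_bij' (fun q _ => q⁻¹) (fun q _ => q⁻¹) ?_ ?_ (by simp) (by simp) (by simp)
  · intro q hq
    obtain ⟨h1, h2⟩ := mem_innerRoots.1 hq
    have h0 := norm_pos_iff.2 (eulerFrobenius.ne_zero_of_eval_eq_zero h1)
    rw [Finset.mem_filter, eulerFrobenius.mem_roots_toFinset, norm_inv, not_lt]
    exact ⟨eulerFrobenius.eval_inv_eq_zero h1, (one_le_inv₀ h0).2 h2.le⟩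
  · intro r hr
    rw [Finset.mem_filter, eulerFrobenius.mem_roots_toFinset, not_lt] at hr
    rw [mem_innerRoots, norm_inv]
    have hne : ‖r‖ ≠ 1 := fun h => eulerFrobenius.eval_ne_zero_of_norm_eq_one hm h hr.1
    exact ⟨eulerFrobenius.eval_inv_eq_zero hr.1,
      inv_lt_one_of_one_lt₀ (lt_of_le_of_ne hr.2 hne.symm)⟩

theorem card_innerRoots {m : ℕ} (hm : 1 ≤ m) : (innerRoots m).card = m - 1 := by
  have h1 := sum_roots_eq_sum_innerRoots hm (fun _ => 1)
  rw [← Finset.card_eq_sum_ones, eulerFrobenius.card_roots_toFinset, Finset.sum_const,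
    smul_eq_mul] at h1
  omega

/-- The residue at a root `r` of `E_{2m-2}` of the function `(1 - z)^(2m) / (z E_{2m-2}(z))`. -/
noncomputable def symbolResidue (m : ℕ) (r : ℂ) : ℂ :=
  (1 - r) ^ (2 * m + 1) / (eulerFrobenius (2 * m - 1)).eval r

/-- The residues at reciprocal roots are related because `E_{2m-1}` has palindromic coefficients. -/
theorem symbolResidue_inv (m : ℕ) (hm : 1 ≤ m) {q : ℂ} (hq : q ≠ 0) :
    symbolResidue m q⁻¹ = -symbolResidue m q / q ^ 2 := by
  obtain ⟨n, rfl⟩ : ∃ n, m = n + 1 := ⟨m - 1, by omega⟩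
  have h1 := eulerFrobenius.pow_mul_eval_inv (2 * (n + 1) - 1) hq
  have h2 : (1 - q⁻¹) ^ (2 * (n + 1) + 1) =
      -(1 - q) ^ (2 * (n + 1) + 1) / q ^ (2 * (n + 1) + 1) := by
    have : 1 - q⁻¹ = -(1 - q) / q := by field_simp; ring
    rw [this, div_pow, Odd.neg_pow ⟨n + 1, rfl⟩]
  have hp : q ^ (2 * (n + 1) + 1) = q ^ (2 * (n + 1) - 1) * q ^ 2 := by
    rw [← pow_add]
    congr 1
  rw [symbolResidue, symbolResidue, ← h1, h2, hp]
  field_simp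

/-- `z - 2 ^ (2n + 1)` is the quotient of `(1 - z) ^ (2n + 2)` by `z E_{2n}(z)`. -/
theorem degree_one_sub_X_pow_sub_lt (n : ℕ) :
    ((1 - X) ^ (2 * n + 2) - X * eulerFrobenius (2 * n) * (X - C (2 ^ (2 * n + 1)))).degree <
      ((2 * n + 1 : ℕ) : WithBot ℕ) := by
  have h1 : ((1 - X : ℂ[X]) ^ (2 * n + 2)) = (X + C (-1)) ^ (2 * n + 2) := by
    rw [← Even.neg_pow ⟨n + 1, by ring⟩]
    simp [sub_eq_add_neg, add_comm]
  have h2 : X * eulerFrobenius (2 * n) * (X - C (2 ^ (2 * n + 1))) =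
      eulerFrobenius (2 * n) * X * X - C (2 ^ (2 * n + 1)) * (eulerFrobenius (2 * n) * X) := by
    ring
  rw [h1, h2, degree_lt_iff_coeff_zero]
  intro j hj
  simp only [coeff_sub, coeff_C_mul, coeff_X_add_C_pow]
  obtain ⟨i, rfl⟩ : ∃ i, j = 2 * n + 1 + i := ⟨j - (2 * n + 1), by omega⟩
  rcases i with _ | _ | i
  · have hc : (eulerFrobenius (2 * n) * X).coeff (2 * n) =
        (2 : ℂ) ^ (2 * n + 1) - 2 * n - 2 := by
      rcases n with _ | n
      · simp
      · rw [show 2 * (n + 1) = 2 * n + 1 + 1 by ring, coeff_mul_X, eulerFrobenius.coeff_succ_self]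
        push_cast
        ring
    rw [add_zero, coeff_mul_X, coeff_mul_X, hc, eulerFrobenius.coeff_self,
      show 2 * n + 2 - (2 * n + 1) = 1 by omega, Nat.choose_succ_self_right]
    push_cast
    ring
  · rw [show 2 * n + 1 + (0 + 1) = 2 * n + 1 + 1 by ring, coeff_mul_X, coeff_mul_X, coeff_mul_X,
      eulerFrobenius.coeff_self, eulerFrobenius.coeff_of_lt (by omega : 2 * n < 2 * n + 1)]
    simp
  · rw [show 2 * n + 1 + (i + 1 + 1) = 2 * n + i + 1 + 1 + 1 by ring, coeff_mul_X, coeff_mul_X,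
      coeff_mul_X, eulerFrobenius.coeff_of_lt (by omega : 2 * n < 2 * n + i + 1),
      eulerFrobenius.coeff_of_lt (by omega : 2 * n < 2 * n + i + 1 + 1),
      Nat.choose_eq_zero_of_lt (by omega)]
    simp

/-- Partial fractions over all roots of `E_{2m-2}`. The polynomial part is read off from the two
leading coefficients, the residues are obtained by Lagrange interpolation at the zeros of
`z E_{2m-2}(z)`. -/
theorem symbol_eq_sum_roots {m : ℕ} (hm : 1 ≤ m) {z : ℂ} (hz : z ≠ 0)
    (hE : (eulerFrobenius (2 * m - 2)).eval z ≠ 0) :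
    (1 - z) ^ (2 * m) / (z * (eulerFrobenius (2 * m - 2)).eval z) =
      z - 2 ^ (2 * m - 1) + 1 / z +
        ∑ r ∈ (eulerFrobenius (2 * m - 2)).roots.toFinset, symbolResidue m r / (z - r) := by
  obtain ⟨n, rfl⟩ : ∃ n, m = n + 1 := ⟨m - 1, by omega⟩
  have hn : 2 * (n + 1) - 2 = 2 * n := by omega
  have hn1 : 2 * (n + 1) - 1 = 2 * n + 1 := by omega
  simp only [symbolResidue, hn1]
  rw [hn] at hE ⊢
  set E := eulerFrobenius (2 * n) with hEdef
  set R := E.roots.toFinset with hR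
  have hmem : ∀ {r}, r ∈ R ↔ E.eval r = 0 := eulerFrobenius.mem_roots_toFinset
  have h0R : (0 : ℂ) ∉ R := fun h => eulerFrobenius.ne_zero_of_eval_eq_zero (hmem.1 h) rfl
  have hnod : Lagrange.nodal (insert 0 R) id = X * E := by
    rw [Lagrange.nodal_insert_eq_nodal h0R, ← eulerFrobenius.eq_nodal]
    simp [hEdef]
  -- Subtracting the polynomial part leaves a polynomial with fewer coefficients than there are
  -- nodes, equal to `(1 - z) ^ (2n + 2)` at each of them.
  set f : ℂ[X] := (1 - X) ^ (2 * n + 2) - X * E * (X - C (2 ^ (2 * n + 1))) with hf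
  have hdeg : f.degree < ((insert 0 R).card : WithBot ℕ) := by
    rw [Finset.card_insert_of_notMem h0R, hR, eulerFrobenius.card_roots_toFinset]
    exact degree_one_sub_X_pow_sub_lt n
  have hint := Lagrange.eq_interpolate (f := f) (s := insert 0 R) (v := id)
    Function.injective_id.injOn hdeg
  have hzs : ∀ i ∈ insert 0 R, z ≠ id i := by
    rintro i hi rfl
    rcases Finset.mem_insert.1 hi with h | h
    · exact hz h
    · exact hE (hmem.1 h)
  have heval := congrArg (eval z) hint
  rw [Lagrange.eval_interpolate_not_at_node _ hzs, hnod] at heval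
  have hw : ∀ i ∈ insert 0 R,
      Lagrange.nodalWeight (insert 0 R) id i = (E.eval i + i * (derivative E).eval i)⁻¹ := by
    intro i hi
    rw [Lagrange.nodalWeight_eq_eval_derivative_nodal hi, hnod]
    simp
  rw [Finset.sum_insert h0R, hw 0 (Finset.mem_insert_self _ _)] at heval
  have hsum : ∑ i ∈ R, Lagrange.nodalWeight (insert 0 R) id i * (z - id i)⁻¹ * eval (id i) f =
      ∑ r ∈ R, (1 - r) ^ (2 * (n + 1) + 1) / (eulerFrobenius (2 * n + 1)).eval r / (z - r) := by
    refine Finset.sum_congr rfl fun r hr => ?_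
    have hr0 := hmem.1 hr
    have h1 := sub_ne_zero.2 (eulerFrobenius.ne_one_of_eval_eq_zero hr0).symm
    have h2 := eulerFrobenius.ne_zero_of_eval_eq_zero hr0
    have h3 := eulerFrobenius.eval_derivative_ne_zero hr0
    have h4 : z - r ≠ 0 := sub_ne_zero.2 (hzs r (Finset.mem_insert_of_mem hr))
    rw [hw r (Finset.mem_insert_of_mem hr), eulerFrobenius.eval_succ_of_eval_eq_zero hr0, hr0]
    simp only [id_eq, hf, eval_sub, eval_mul, eval_pow, eval_X, Polynomial.eval_one, hr0]
    rw [← hEdef] at h3 ⊢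
    field_simp
    ring
  rw [hsum] at heval
  have hE0 : E.eval 0 = 1 := eulerFrobenius.eval_zero _
  simp only [hf, id_eq, hE0, eval_sub, eval_mul, eval_pow, eval_X, Polynomial.eval_one, eval_C,
    zero_mul, sub_zero, one_pow, add_zero, inv_one, one_mul, mul_one] at heval
  rw [div_eq_iff (mul_ne_zero hz hE)]
  have hzz : z * z⁻¹ = 1 := mul_inv_cancel₀ hz
  rw [one_div]
  rw [show 2 * (n + 1) = 2 * n + 2 by ring] at *
  linear_combination heval

/-- The expansion of the symbol whose terms are, on the unit circle, geometric series. -/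
theorem symbol_eq_sum_innerRoots {m : ℕ} (hm : 1 ≤ m) {z : ℂ} (hz : ‖z‖ = 1) :
    (1 - z) ^ (2 * m) / (z * (eulerFrobenius (2 * m - 2)).eval z) =
      -2 ^ (2 * m - 1) + z + z⁻¹ + ∑ q ∈ innerRoots m, symbolResidue m q / q *
        ((1 - q * z)⁻¹ + q * z⁻¹ * (1 - q * z⁻¹)⁻¹) := by
  have hz0 : z ≠ 0 := norm_pos_iff.1 (by rw [hz]; exact one_pos)
  have hE := eulerFrobenius.eval_ne_zero_of_norm_eq_one hm hz
  rw [symbol_eq_sum_roots hm hz0 hE, sum_roots_eq_sum_innerRoots hm]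
  have : ∀ q ∈ innerRoots m, symbolResidue m q / (z - q) + symbolResidue m q⁻¹ / (z - q⁻¹) =
      symbolResidue m q / q * ((1 - q * z)⁻¹ + q * z⁻¹ * (1 - q * z⁻¹)⁻¹) := by
    intro q hq
    have hq0 := (mem_innerRoots.1 hq).1
    have h0 := eulerFrobenius.ne_zero_of_eval_eq_zero hq0
    have h1 : z - q ≠ 0 := sub_ne_zero.2 fun h => hE (h ▸ hq0)
    have h2 : z - q⁻¹ ≠ 0 := sub_ne_zero.2 fun h => hE (h ▸ eulerFrobenius.eval_inv_eq_zero hq0)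
    have h3 : 1 - q * z ≠ 0 := by
      intro h
      apply h2
      field_simp
      linear_combination -h
    have h4 : 1 - q * z⁻¹ ≠ 0 := by
      intro h
      apply h1
      field_simp at h
      simpa using h
    have h5 : (1 - q * z⁻¹)⁻¹ = z / (z - q) := by
      field_simp
    have h6 : (z - q⁻¹)⁻¹ = - q * (1 - q * z)⁻¹ := by
      have : z - q⁻¹ = -(1 - q * z) / q := by field_simp; ring
      rw [this, inv_div, div_neg]
      ring
    rw [symbolResidue_inv m hm h0, h5, div_eq_mul_inv _ (z - q⁻¹), h6]
    field_simp
    ring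
  rw [Finset.sum_congr rfl this]
  ring

end PartialFractions

/-! ### The Fourier series of the discrete operator -/

section FourierSeries

theorem hasSum_pow_natAbs_mul_zpow {q z : ℂ} (hq : ‖q‖ < 1) (hz : ‖z‖ = 1) :
    HasSum (fun β : ℤ => q ^ β.natAbs * z ^ β)
      ((1 - q * z)⁻¹ + q * z⁻¹ * (1 - q * z⁻¹)⁻¹) := by
  have hz0 : z ≠ 0 := norm_pos_iff.1 (by rw [hz]; exact one_pos)
  refine HasSum.of_nat_of_neg_add_one ?_ ?_
  · refine (hasSum_geometric_of_norm_lt_one (ξ := q * z)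
      (by rwa [norm_mul, hz, mul_one])).congr_fun fun n => ?_
    rw [mul_pow]
    simp
  · refine ((hasSum_geometric_of_norm_lt_one (ξ := q * z⁻¹)
      (by rwa [norm_mul, norm_inv, hz, inv_one, mul_one])).mul_left (q * z⁻¹)).congr_fun fun n => ?_
    have : (-((n : ℤ) + 1)).natAbs = n + 1 := by omega
    rw [this, zpow_neg, ← Nat.cast_succ, zpow_natCast, ← inv_pow, ← mul_pow, ← pow_succ']

/-- `D_h^{(m)}` as a finitely supported part plus a combination of the sequences `q ^ |β|`. -/
theorem discreteD_eq (m : ℕ) (h : ℝ) (β : ℤ) : discreteD m h β =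
    ((2 * m - 1).factorial : ℂ) / (h : ℂ) ^ (2 * m) *
      ((if β = 0 then -2 ^ (2 * m - 1) else 0) + (if β = 1 then 1 else 0) +
        (if β = -1 then 1 else 0) + ∑ q ∈ innerRoots m, symbolResidue m q / q * q ^ β.natAbs) := by
  have hres : ∀ k : ℕ, ∀ q, symbolResidue m q / q * q ^ k =
      (1 - q) ^ (2 * m + 1) * q ^ k / (q * (eulerFrobenius (2 * m - 1)).eval q) := by
    intro k q
    rw [symbolResidue, div_div, mul_comm q, div_mul_eq_mul_div]
  rw [discreteD]
  congr 1
  simp only [hres]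
  rcases eq_or_ne β 0 with rfl | h0
  · simp
  by_cases h1 : β.natAbs = 1
  · have hsum : ∀ q ∈ innerRoots m, (1 - q) ^ (2 * m + 1) * q ^ β.natAbs /
        (q * (eulerFrobenius (2 * m - 1)).eval q) =
        (1 - q) ^ (2 * m + 1) / (eulerFrobenius (2 * m - 1)).eval q := by
      intro q hq
      have hq0 := eulerFrobenius.ne_zero_of_eval_eq_zero (mem_innerRoots.1 hq).1
      rw [h1, pow_one, mul_comm q, mul_div_mul_right _ _ hq0]
    rw [Finset.sum_congr rfl hsum]
    rcases Int.natAbs_eq_iff.1 h1 with rfl | rfl <;> simp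
  · have h2 : β ≠ 1 := by rintro rfl; exact h1 rfl
    have h3 : β ≠ -1 := by rintro rfl; exact h1 rfl
    simp [h0, h1, h2, h3]

/-- The Fourier series of `D_h^{(m)}` in terms of the point `z` of the unit circle. -/
theorem hasSum_discreteD_mul_zpow {m : ℕ} (hm : 1 ≤ m) (h : ℝ) {z : ℂ} (hz : ‖z‖ = 1) :
    HasSum (fun β : ℤ => discreteD m h β * z ^ β)
      (((2 * m - 1).factorial : ℂ) / (h : ℂ) ^ (2 * m) *
        ((1 - z) ^ (2 * m) / (z * (eulerFrobenius (2 * m - 2)).eval z))) := by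
  rw [symbol_eq_sum_innerRoots hm hz]
  have h1 : HasSum (fun β : ℤ => ∑ q ∈ innerRoots m,
      symbolResidue m q / q * (q ^ β.natAbs * z ^ β)) _ :=
    hasSum_sum fun q hq => (hasSum_pow_natAbs_mul_zpow (mem_innerRoots.1 hq).2 hz).mul_left
      (symbolResidue m q / q)
  have h2 := (((hasSum_ite_eq (0 : ℤ) (-2 ^ (2 * m - 1) : ℂ)).add (hasSum_ite_eq (1 : ℤ) z)).add
    (hasSum_ite_eq (-1 : ℤ) z⁻¹)).add h1
  refine (h2.mul_left (((2 * m - 1).factorial : ℂ) / (h : ℂ) ^ (2 * m))).congr_fun ?_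
  intro β
  rw [discreteD_eq, mul_assoc, add_mul, add_mul, add_mul, Finset.sum_mul]
  congr 1
  congr 1
  · congr 1
    · congr 1
      · split_ifs with h
        · simp [h]
        · simp
      · split_ifs with h
        · simp [h]
        · simp
    · split_ifs with h
      · simp [h]
      · simp
  · exact Finset.sum_congr rfl fun q _ => by ring

theorem summable_discreteD {m : ℕ} (hm : 1 ≤ m) (h : ℝ) : Summable (discreteD m h) := by
  simpa using (hasSum_discreteD_mul_zpow hm h (z := 1) (by simp)).summable

end FourierSeries

/-! ### The symbol of the discrete operator -/

section Symbol

open Complex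

theorem exp_eq_zpow (p h : ℝ) (β : ℤ) :
    exp (2 * Real.pi * I * p * h * β) = exp (2 * Real.pi * I * p * h) ^ β := by
  rw [← exp_int_mul]
  ring_nf

theorem norm_exp_two_pi_I_mul (p h : ℝ) : ‖exp (2 * Real.pi * I * p * h)‖ = 1 := by
  rw [show (2 * Real.pi * I * p * h : ℂ) = ((2 * Real.pi * p * h : ℝ) : ℂ) * I by push_cast; ring,
    norm_exp_ofReal_mul_I]

/-- The Fourier series of `D_h^{(m)}` as a rational function of `exp (2πihp)`. -/
theorem harrowFourier_discreteD {m : ℕ} (hm : 1 ≤ m) (h p : ℝ) :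
    harrowFourier h (discreteD m h) p = h * (((2 * m - 1).factorial : ℂ) / (h : ℂ) ^ (2 * m) *
      ((1 - exp (2 * Real.pi * I * p * h)) ^ (2 * m) / (exp (2 * Real.pi * I * p * h) *
        (eulerFrobenius (2 * m - 2)).eval (exp (2 * Real.pi * I * p * h))))) := by
  rw [harrowFourier]
  simp only [exp_eq_zpow, mul_assoc (h : ℂ)]
  rw [tsum_mul_left, (hasSum_discreteD_mul_zpow hm h (norm_exp_two_pi_I_mul p h)).tsum_eq]

/-- By Lipschitz's formula, `Γ_h^{(m)}` is the Fourier series of `D_h^{(m)}`. -/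
theorem harrowFourier_discreteD_eq_symbolGamma {m : ℕ} (hm : 1 ≤ m) {h p : ℝ} (hh : h ≠ 0)
    (hp : ∀ γ : ℤ, p ≠ h⁻¹ * γ) :
    harrowFourier h (discreteD m h) p = ((h * symbolGamma m h p : ℝ) : ℂ) := by
  have hx : ∀ n : ℤ, p * h ≠ n := by
    intro n hn
    apply hp n
    rw [← hn]
    field_simp
  have hL := tsum_one_div_add_int_pow_eq_eulerFrobenius hx hm
  rw [ofReal_mul, ← mul_assoc (2 * Real.pi * I : ℂ)] at hL
  rw [harrowFourier_discreteD hm, ofReal_mul]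
  congr 1
  have hsum : ∑' γ : ℤ, 1 / (p - h⁻¹ * γ) ^ (2 * m) =
      h ^ (2 * m) * ∑' n : ℤ, 1 / (p * h + n) ^ (2 * m) := by
    rw [← (Equiv.neg ℤ).tsum_eq, ← tsum_mul_left]
    congr 1
    ext γ
    simp only [Equiv.neg_apply, Int.cast_neg]
    rw [show p - h⁻¹ * -γ = (p * h + γ) / h by field_simp; ring, div_pow, one_div_div,
      mul_one_div]
  have hcast : ((∑' n : ℤ, 1 / (p * h + n) ^ (2 * m) : ℝ) : ℂ) =
      ∑' n : ℤ, 1 / ((p : ℂ) * h + n) ^ (2 * m) := by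
    push_cast
    rfl
  rw [symbolGamma, hsum]
  push_cast [hcast]
  push_cast at hcast
  rw [hL]
  have hI : (2 * Real.pi * I : ℂ) ^ (2 * m) = (2 * Real.pi) ^ (2 * m) * (-1) ^ m := by
    rw [mul_pow, pow_mul I, I_sq]
  have hpi : (2 * Real.pi : ℂ) ^ (2 * m) ≠ 0 := by
    refine pow_ne_zero _ ?_
    exact_mod_cast Real.two_pi_pos.ne'
  have hs : ((-1 : ℂ) ^ m) * (-1) ^ m = 1 := by rw [← mul_pow]; simp
  rw [hI]
  generalize exp (2 * Real.pi * I * p * h) = z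
  rw [show ((-1 : ℂ) ^ m / (2 * Real.pi) ^ (2 * m) * (h ^ (2 * m) * ((2 * Real.pi) ^ (2 * m) *
    (-1) ^ m / (2 * m - 1).factorial * (z * Polynomial.eval z (eulerFrobenius (2 * m - 2)) /
      (1 - z) ^ (2 * m))))) = ((-1) ^ m * (-1) ^ m) *
      ((2 * Real.pi) ^ (2 * m) / (2 * Real.pi) ^ (2 * m)) *
      (h ^ (2 * m) / (2 * m - 1).factorial * (z * Polynomial.eval z (eulerFrobenius (2 * m - 2)) /
      (1 - z) ^ (2 * m))) by ring, hs, div_self hpi, one_mul, one_mul, mul_inv, inv_div, inv_div]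

/-- On `h⁻¹ ℤ` the Fourier series vanishes because of the factor `(1 - z)^(2m)` at `z = 1`. -/
theorem harrowFourier_discreteD_eq_zero {m : ℕ} (hm : 1 ≤ m) {h p : ℝ} (hh : h ≠ 0)
    (hp : ∃ γ : ℤ, p = h⁻¹ * γ) : harrowFourier h (discreteD m h) p = 0 := by
  obtain ⟨γ, rfl⟩ := hp
  have : exp (2 * Real.pi * I * (h⁻¹ * γ : ℝ) * h) = 1 := by
    have hc : (h : ℂ) ≠ 0 := by exact_mod_cast hh
    refine exp_eq_one_iff.2 ⟨γ, ?_⟩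
    push_cast
    field_simp
  rw [harrowFourier_discreteD hm, this, sub_self, zero_pow (by omega)]
  simp

end Symbol

/-! ### Fourier transforms of harrow-shaped distributions -/

section Distribution

open MeasureTheory

theorem norm_harrowFourier_term (h : ℝ) (ψ : ℤ → ℂ) (p : ℝ) (β : ℤ) :
    ‖(h : ℂ) * ψ β * Complex.exp (2 * Real.pi * Complex.I * p * h * β)‖ = ‖(h : ℂ) * ψ β‖ := by
  rw [norm_mul, exp_eq_zpow, norm_zpow, norm_exp_two_pi_I_mul, one_zpow, mul_one]

theorem continuous_harrowFourier (h : ℝ) {ψ : ℤ → ℂ} (hψ : Summable ψ) :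
    Continuous (harrowFourier h ψ) :=
  continuous_tsum (fun _ => by fun_prop) (hψ.mul_left (h : ℂ)).norm
    fun β p => (norm_harrowFourier_term h ψ p β).le

theorem norm_harrowFourier_le (h : ℝ) {ψ : ℤ → ℂ} (hψ : Summable ψ) (p : ℝ) :
    ‖harrowFourier h ψ p‖ ≤ ∑' β : ℤ, ‖(h : ℂ) * ψ β‖ :=
  tsum_of_norm_bounded (hψ.mul_left (h : ℂ)).norm.hasSum
    fun β => (norm_harrowFourier_term h ψ p β).le

/-- Point evaluations are bounded functionals on bounded continuous functions, so the series of the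
functionals `φ ↦ h ψ[β] φ(hβ)` converges in operator norm. -/
theorem exists_isHarrow (h : ℝ) {ψ : ℤ → ℂ} (hψ : Summable ψ) :
    ∃ T : 𝓢'(ℝ, ℂ), IsHarrow h ψ T := by
  let e : ℤ → (BoundedContinuousFunction ℝ ℂ →L[ℂ] ℂ) := fun β =>
    ((h : ℂ) * ψ β) • BoundedContinuousFunction.evalCLM ℂ (h * β : ℝ)
  have he : Summable e := by
    refine Summable.of_norm_bounded (hψ.mul_left (h : ℂ)).norm fun β => ?_
    refine ContinuousLinearMap.opNorm_le_bound _ (norm_nonneg _) fun φ => ?_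
    simp only [e, smul_apply, BoundedContinuousFunction.evalCLM_apply,
      smul_eq_mul, norm_mul]
    gcongr
    exact φ.norm_coe_le_norm _
  refine ⟨ContinuousLinearMap.toPointwiseConvergenceCLM _ _ _ _
    ((∑' β, e β) ∘L SchwartzMap.toBoundedContinuousFunctionCLM ℂ ℝ ℂ), fun φ => ?_⟩
  exact (he.hasSum.mapL (ContinuousLinearMap.apply ℂ ℂ
    (SchwartzMap.toBoundedContinuousFunctionCLM ℂ ℝ ℂ φ)))

/-- The Fourier transform of a harrow-shaped distribution with summable coefficients is computed
term by term. -/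
theorem IsHarrow.isGivenBy_fourierInv {h : ℝ} {ψ : ℤ → ℂ} (hψ : Summable ψ) {T : 𝓢'(ℝ, ℂ)}
    (hT : IsHarrow h ψ T) : IsGivenBy (𝓕⁻ T) (harrowFourier h ψ) := by
  intro φ
  refine ⟨φ.integrable.mul_bdd (c := ∑' β : ℤ, ‖(h : ℂ) * ψ β‖)
    (continuous_harrowFourier h hψ).aestronglyMeasurable
    (Filter.Eventually.of_forall (norm_harrowFourier_le h hψ)), ?_⟩
  let F : ℤ → ℝ → ℂ := fun β p =>
    φ p * ((h : ℂ) * ψ β * Complex.exp (2 * Real.pi * Complex.I * p * h * β))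
  have hnorm : ∀ β p, ‖F β p‖ = ‖φ p‖ * ‖(h : ℂ) * ψ β‖ := fun β p => by
    simp only [F]
    rw [norm_mul, norm_harrowFourier_term]
  have hint : ∀ β, Integrable (F β) := fun β =>
    φ.integrable.mul_bdd (c := ‖(h : ℂ) * ψ β‖) (by fun_prop)
      (Filter.Eventually.of_forall fun p => (norm_harrowFourier_term h ψ p β).le)
  have hsum : Summable fun β => ∫ p, ‖F β p‖ := by
    simp only [hnorm, integral_mul_const]
    exact (hψ.mul_left (h : ℂ)).norm.mul_left _
  have h1 := hasSum_integral_of_summable_integral_norm hint hsum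
  have h2 := hT (𝓕⁻ φ)
  have h3 : ∀ β, (h : ℂ) * ψ β * (𝓕⁻ φ) (h * β) = ∫ p, F β p := by
    intro β
    rw [SchwartzMap.fourierInv_coe, Real.fourierInv_eq', ← integral_const_mul]
    congr 1
    ext p
    simp only [F, smul_eq_mul]
    have : ((2 * Real.pi * inner ℝ p (h * (β : ℝ)) : ℝ) : ℂ) * Complex.I =
        2 * Real.pi * Complex.I * p * h * β := by
      simp
      ring
    rw [this]
    ring
  simp only [h3] at h2
  rw [TemperedDistribution.fourierInv_apply, h2.unique h1]
  congr 1
  ext p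
  simp only [F, harrowFourier, tsum_mul_left]

theorem IsGivenBy.congr_ae {T : 𝓢'(ℝ, ℂ)} {f g : ℝ → ℂ} (hT : IsGivenBy T f)
    (hfg : f =ᵐ[volume] g) : IsGivenBy T g := by
  intro φ
  have h1 : (fun p => φ p * f p) =ᵐ[volume] fun p => φ p * g p := hfg.mono fun p hp => by
    simp only [hp]
  exact ⟨(hT φ).1.congr h1, (hT φ).2.trans (integral_congr_ae h1)⟩

end Distribution

/-! ### Discrete Fourier analysis of the convolution equation -/

section Convolution

open Complex

/-- The Fourier coefficients `(2πiγ)^(-2m)` of `B_{2m}`. At `γ = 0` the value is `0`, as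
division by zero gives. -/
noncomputable def bernoulliWeight (m : ℕ) (γ : ℤ) : ℂ := 1 / (2 * Real.pi * I * γ) ^ (2 * m)

theorem discreteB_eq {m : ℕ} (hm : 1 ≤ m) (h : ℝ) (β : ℤ) : discreteB m h β =
    ∑' γ : ℤ, bernoulliWeight m γ * exp (-(2 * Real.pi * I * γ * h * β)) := by
  rw [discreteB]
  congr 1
  ext γ
  split_ifs with h0
  · simp [bernoulliWeight, h0, show m ≠ 0 by omega]
  · rw [bernoulliWeight, one_div_mul_eq_div]
    congr 2
    ring

theorem bernoulliWeight_eq (m : ℕ) (γ : ℤ) : bernoulliWeight m γ =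
    (((-1) ^ m / (2 * Real.pi) ^ (2 * m) * (1 / (γ : ℝ) ^ (2 * m)) : ℝ) : ℂ) := by
  have hI : (2 * Real.pi * I * γ : ℂ) ^ (2 * m) =
      (2 * Real.pi) ^ (2 * m) * (-1) ^ m * γ ^ (2 * m) := by
    rw [mul_pow, mul_pow _ I, pow_mul I, I_sq]
  have hs : ((-1 : ℂ) ^ m) * (-1) ^ m = 1 := by rw [← mul_pow]; simp
  have hs' : ((-1 : ℂ) ^ m)⁻¹ = (-1) ^ m := inv_eq_of_mul_eq_one_right hs
  rw [bernoulliWeight, hI, one_div, mul_inv, mul_inv, hs']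
  push_cast
  ring

theorem summable_norm_bernoulliWeight {m : ℕ} (hm : 1 ≤ m) :
    Summable fun γ => ‖bernoulliWeight m γ‖ := by
  refine Summable.norm ?_
  have hs := (Real.summable_one_div_int_pow.2 (by omega : 1 < 2 * m)).mul_left
    ((-1 : ℝ) ^ m / (2 * Real.pi) ^ (2 * m))
  exact (summable_ofReal.2 hs).congr fun γ => (bernoulliWeight_eq m γ).symm

theorem norm_exp_neg_two_pi_I_mul (h : ℝ) (γ β : ℤ) :
    ‖exp (-(2 * Real.pi * I * γ * h * β))‖ = 1 := by
  rw [show (-(2 * Real.pi * I * γ * h * β) : ℂ) = ((-(2 * Real.pi * γ * h * β) : ℝ) : ℂ) * I by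
    push_cast; ring, norm_exp_ofReal_mul_I]

/-- Absolute convergence of the double series obtained by inserting the Fourier series of `B_{2m}`
into the convolution `f * B_{2m}`. -/
theorem summable_uncurry_discreteConv {m : ℕ} (hm : 1 ≤ m) (h : ℝ) {f : ℤ → ℂ} (hf : Summable f)
    (β : ℤ) : Summable (Function.uncurry fun a γ : ℤ =>
      f a * (bernoulliWeight m γ * exp (-(2 * Real.pi * I * γ * h * (β - a : ℤ))))) := by
  have := hf.norm.mul_of_nonneg (summable_norm_bernoulliWeight hm) (fun _ => norm_nonneg _)
    (fun _ => norm_nonneg _)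
  refine Summable.of_norm_bounded this fun x => ?_
  rw [Function.uncurry_apply_pair, norm_mul, norm_mul, norm_exp_neg_two_pi_I_mul, mul_one]

theorem summable_discreteConv {m : ℕ} (hm : 1 ≤ m) (h : ℝ) {f : ℤ → ℂ} (hf : Summable f) (β : ℤ) :
    Summable fun γ : ℤ => f γ * discreteB m h (β - γ) := by
  have := (summable_uncurry_discreteConv hm h hf β).prod
  simpa only [Function.uncurry_apply_pair, tsum_mul_left, ← discreteB_eq hm] using this

/-- The Fourier series of the convolution `h f * B_{2m}`. -/
theorem mul_discreteConv_eq_tsum {m : ℕ} (hm : 1 ≤ m) (h : ℝ) {f : ℤ → ℂ} (hf : Summable f)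
    (β : ℤ) : h * discreteConv f (discreteB m h) β =
      ∑' γ : ℤ, exp (-(2 * Real.pi * I * γ * h * β)) *
        (harrowFourier h f γ * bernoulliWeight m γ) := by
  have hcomm := (summable_uncurry_discreteConv hm h hf β).tsum_comm
  simp only [tsum_mul_left, ← discreteB_eq hm] at hcomm
  rw [discreteConv, ← hcomm, ← tsum_mul_left]
  congr 1
  ext γ
  rw [harrowFourier, ← tsum_mul_right, ← tsum_mul_left, ← tsum_mul_left]
  congr 1
  ext a
  have : exp (-(2 * Real.pi * I * γ * h * (β - a : ℤ))) =
      exp (-(2 * Real.pi * I * γ * h * β)) * exp (2 * Real.pi * I * (γ : ℝ) * h * a) := by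
    rw [← exp_add]
    push_cast
    ring_nf
  rw [this]
  ring

theorem summable_mul_bernoulliWeight {m : ℕ} (hm : 1 ≤ m) (h : ℝ) {f : ℤ → ℂ} (hf : Summable f)
    (β : ℤ) : Summable fun γ : ℤ => exp (-(2 * Real.pi * I * γ * h * β)) *
      (harrowFourier h f γ * bernoulliWeight m γ) := by
  refine Summable.of_norm_bounded
    ((summable_norm_bernoulliWeight hm).mul_left (∑' β : ℤ, ‖(h : ℂ) * f β‖)) fun γ => ?_
  rw [norm_mul, norm_mul, norm_exp_neg_two_pi_I_mul, one_mul]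
  gcongr
  exact norm_harrowFourier_le h hf γ

/-- Summation over `ℤ` by residue classes modulo `N`. -/
theorem tsum_int_eq_sum_fin_tsum (N : ℕ) [NeZero N] {g : ℤ → ℂ} (hg : Summable g) :
    ∑' γ, g γ = ∑ r : Fin N, ∑' k : ℤ, g (k * N + (r : ℕ)) := by
  let e : Fin N × ℤ ≃ ℤ := (Equiv.prodComm (Fin N) ℤ).trans (Int.divModEquiv N).symm
  have hs : Summable fun x : Fin N × ℤ => g (x.2 * N + (x.1 : ℕ)) := by
    refine (e.summable_iff.2 hg).congr fun x => ?_
    simp [e, Int.divModEquiv_symm_apply]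
  rw [← e.tsum_eq g, ← tsum_fintype (L := .unconditional _), ← hs.tsum_prod]
  simp [e, Int.divModEquiv_symm_apply]

/-- The sum of the Fourier coefficients of `B_{2m}` over the residue class of `p` modulo `N`. -/
noncomputable def periodicWeight (m N : ℕ) (p : ℤ) : ℂ := ∑' k : ℤ, bernoulliWeight m (k * N + p)

/-- Up to a real factor a periodised weight is a sum of even powers, hence it is nonzero. This
includes `p ∈ N ℤ`, where the term with `k * N + p = 0` is missing. -/
theorem periodicWeight_ne_zero {m N : ℕ} (hm : 1 ≤ m) (hN : 1 ≤ N) (p : ℤ) :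
    periodicWeight m N p ≠ 0 := by
  have hinj : Function.Injective fun k : ℤ => k * N + p := by
    intro a b hab
    have hN0 : N ≠ 0 := by omega
    simpa [hN0] using hab
  have hs : Summable fun k : ℤ => 1 / ((k * N + p : ℤ) : ℝ) ^ (2 * m) :=
    (Real.summable_one_div_int_pow.2 (by omega : 1 < 2 * m)).comp_injective hinj
  obtain ⟨k, hk⟩ : ∃ k : ℤ, k * N + p ≠ 0 := by
    by_contra! hall
    have h0 := hall 0
    have h1 := hall 1
    omega
  have hpos : 0 < ∑' k : ℤ, 1 / ((k * N + p : ℤ) : ℝ) ^ (2 * m) := by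
    refine hs.tsum_pos (fun k => div_nonneg zero_le_one ((even_two_mul m).pow_nonneg _)) k ?_
    exact one_div_pos.2 ((even_two_mul m).pow_pos (by exact_mod_cast hk))
  simp only [periodicWeight, bernoulliWeight_eq]
  rw [← ofReal_tsum, tsum_mul_left, ofReal_ne_zero]
  have := Real.pi_pos
  exact mul_ne_zero (div_ne_zero (pow_ne_zero _ (by norm_num)) (by positivity)) hpos.ne'

theorem periodicWeight_add_mul (m N : ℕ) (p k : ℤ) :
    periodicWeight m N (k * N + p) = periodicWeight m N p := by
  rw [periodicWeight, periodicWeight,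
    ← (Equiv.addRight k).tsum_eq fun j : ℤ => bernoulliWeight m (j * N + p)]
  congr 1
  ext j
  simp only [Equiv.coe_addRight]
  ring_nf

/-- `Γ_h^{(m)}` is the reciprocal of the periodised Fourier coefficients of `B_{2m}`. For
`p ∈ N ℤ` both sides omit the singular term, so that the identity needs no case distinction. -/
theorem symbolGamma_eq_inv_periodicWeight (m : ℕ) {N : ℕ} {h : ℝ} (hh : h = 1 / (N : ℝ)) (p : ℤ) :
    (symbolGamma m h p : ℂ) = (periodicWeight m N p)⁻¹ := by
  simp only [periodicWeight, bernoulliWeight_eq]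
  rw [← ofReal_tsum, tsum_mul_left, symbolGamma, ofReal_inv, hh, one_div, inv_inv,
    ← (Equiv.neg ℤ).tsum_eq (fun γ : ℤ => 1 / ((p : ℝ) - N * γ) ^ (2 * m))]
  congr 5
  ext k
  simp only [Equiv.neg_apply]
  push_cast
  ring_nf

theorem exp_two_pi_I_eq_zpow {N : ℕ} {h : ℝ} (hh : h = 1 / (N : ℝ)) (p β : ℤ) :
    exp (2 * Real.pi * I * p * h * β) = exp (2 * Real.pi * I / N) ^ (p * β) := by
  rw [← exp_int_mul, hh]
  push_cast
  ring_nf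

theorem exp_two_pi_I_add_mul {N : ℕ} (hN : 1 ≤ N) {h : ℝ} (hh : h = 1 / (N : ℝ)) (p k β : ℤ) :
    exp (2 * Real.pi * I * (k * N + p : ℤ) * h * β) = exp (2 * Real.pi * I * p * h * β) := by
  have hprim := isPrimitiveRoot_exp N (by omega)
  rw [exp_two_pi_I_eq_zpow hh, exp_two_pi_I_eq_zpow hh, add_mul,
    zpow_add₀ (exp_ne_zero _), (hprim.zpow_eq_one_iff_dvd _).2 ⟨k * β, by ring⟩, one_mul]

theorem harrowFourier_add_mul {N : ℕ} (hN : 1 ≤ N) {h : ℝ} (hh : h = 1 / (N : ℝ)) (f : ℤ → ℂ)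
    (p k : ℤ) : harrowFourier h f (k * N + p : ℤ) = harrowFourier h f p := by
  simp only [harrowFourier, ofReal_intCast, exp_two_pi_I_add_mul hN hh]

/-- The discrete Fourier expansion of `h f * B_{2m}`: as `harrowFourier h f` is `N`-periodic on the
integers, its frequencies `γ` may be grouped modulo `N`. -/
theorem mul_discreteConv_eq_sum {m N : ℕ} (hm : 1 ≤ m) (hN : 1 ≤ N) {h : ℝ} (hh : h = 1 / (N : ℝ))
    {f : ℤ → ℂ} (hf : Summable f) (β : ℤ) : h * discreteConv f (discreteB m h) β =
      ∑ r : Fin N, exp (-(2 * Real.pi * I * ((r : ℕ) : ℤ) * h * β)) *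
        (harrowFourier h f ((r : ℕ) : ℤ) * periodicWeight m N (r : ℕ)) := by
  have : NeZero N := ⟨by omega⟩
  rw [mul_discreteConv_eq_tsum hm h hf,
    tsum_int_eq_sum_fin_tsum N (summable_mul_bernoulliWeight hm h hf β)]
  refine Finset.sum_congr rfl fun r _ => ?_
  simp only [harrowFourier_add_mul hN hh, exp_neg, exp_two_pi_I_add_mul hN hh, tsum_mul_left,
    periodicWeight]

theorem discretePhi_eq {N : ℕ} (hN : 1 ≤ N) {h : ℝ} (hh : h = 1 / (N : ℝ)) (β : ℤ) :
    discretePhi h β = if (N : ℤ) ∣ β then 1 else 0 := by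
  have hiff : ∀ γ : ℤ, (β : ℝ) = γ * h⁻¹ ↔ β = γ * N := by
    intro γ
    rw [hh, one_div, inv_inv]
    exact_mod_cast Iff.rfl
  simp only [discretePhi, hiff]
  split_ifs with hd
  · obtain ⟨c, rfl⟩ := hd
    have hN0 : (N : ℤ) ≠ 0 := by omega
    have : ∀ γ : ℤ, N * c = γ * N ↔ γ = c := by
      intro γ
      rw [mul_comm γ, mul_right_inj' hN0, eq_comm]
    simp only [this]
    exact tsum_ite_eq c _
  · have : ∀ γ : ℤ, ¬ β = γ * N := fun γ h => hd ⟨γ, by rw [h, mul_comm]⟩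
    simp [this]

/-- The discrete Fourier expansion of `Φ - h`: all frequencies but `0` occur, with coefficient
`h`. -/
theorem discretePhi_sub_eq_sum {N : ℕ} (hN : 1 ≤ N) {h : ℝ} (hh : h = 1 / (N : ℝ)) (β : ℤ) :
    discretePhi h β - h = ∑ r : Fin N, exp (-(2 * Real.pi * I * ((r : ℕ) : ℤ) * h * β)) *
      (if (N : ℤ) ∣ (r : ℕ) then 0 else (h : ℂ)) := by
  have : NeZero N := ⟨by omega⟩
  have hN0 : (N : ℂ) ≠ 0 := by exact_mod_cast this.ne
  have hhc : (h : ℂ) = 1 / N := by rw [hh]; push_cast; rfl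
  have hprim := isPrimitiveRoot_exp N this.ne
  have hgeom : ∑ r : Fin N, exp (-(2 * Real.pi * I * ((r : ℕ) : ℤ) * h * β)) =
      if (N : ℤ) ∣ β then (N : ℂ) else 0 := by
    have hpow : ∀ r : ℕ, exp (-(2 * Real.pi * I * (r : ℤ) * h * β)) =
        (exp (2 * Real.pi * I / N) ^ (-β)) ^ r := by
      intro r
      rw [exp_neg, exp_two_pi_I_eq_zpow hh, ← zpow_neg, ← zpow_natCast, ← zpow_mul]
      ring_nf
    simp only [hpow]
    rw [Fin.sum_univ_eq_sum_range (fun r => (exp (2 * Real.pi * I / N) ^ (-β)) ^ r)]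
    split_ifs with hd
    · rw [(hprim.zpow_eq_one_iff_dvd _).2 ((dvd_neg).2 hd)]
      simp
    · have hne : exp (2 * Real.pi * I / N) ^ (-β) ≠ 1 := by
        rwa [Ne, hprim.zpow_eq_one_iff_dvd, dvd_neg]
      rw [geom_sum_eq hne, ← zpow_natCast, ← zpow_mul,
        (hprim.zpow_eq_one_iff_dvd _).2 ⟨-β, by ring⟩, sub_self, zero_div]
  have hsplit : ∀ r : Fin N, exp (-(2 * Real.pi * I * ((r : ℕ) : ℤ) * h * β)) *
      (if (N : ℤ) ∣ (r : ℕ) then 0 else (h : ℂ)) =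
      exp (-(2 * Real.pi * I * ((r : ℕ) : ℤ) * h * β)) * h - if r = 0 then (h : ℂ) else 0 := by
    intro r
    have hiff : (N : ℤ) ∣ (r : ℕ) ↔ r = 0 := by
      rw [Int.natCast_dvd_natCast, ← Fin.val_eq_zero_iff]
      exact ⟨fun hd => Nat.eq_zero_of_dvd_of_lt hd r.2, fun h0 => h0 ▸ dvd_zero _⟩
    simp only [hiff]
    split_ifs with h0
    · simp [h0]
    · ring
  rw [Finset.sum_congr rfl fun r _ => hsplit r, Finset.sum_sub_distrib, ← Finset.sum_mul, hgeom,
    discretePhi_eq hN hh, Finset.sum_ite_eq' Finset.univ (0 : Fin N)]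
  simp only [Finset.mem_univ, if_true]
  split_ifs
  · rw [hhc, mul_one_div_cancel hN0]
  · simp

/-- Uniqueness of discrete Fourier coefficients, from the Vandermonde determinant. -/
theorem eq_of_sum_exp_mul_eq {N : ℕ} (hN : 1 ≤ N) {h : ℝ} (hh : h = 1 / (N : ℝ))
    {u v : Fin N → ℂ}
    (huv : ∀ β : ℤ, ∑ r : Fin N, exp (-(2 * Real.pi * I * ((r : ℕ) : ℤ) * h * β)) * u r =
      ∑ r : Fin N, exp (-(2 * Real.pi * I * ((r : ℕ) : ℤ) * h * β)) * v r) : u = v := by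
  have hprim := (isPrimitiveRoot_exp N (by omega)).inv
  rw [← sub_eq_zero]
  refine Matrix.eq_zero_of_forall_pow_sum_mul_pow_eq_zero
    (f := fun r : Fin N => (exp (2 * Real.pi * I / N))⁻¹ ^ (r : ℕ)) ?_ ?_
  · intro r s hrs
    exact Fin.ext (hprim.pow_inj r.2 s.2 hrs)
  · intro i
    have := huv (i : ℕ)
    rw [← sub_eq_zero, ← Finset.sum_sub_distrib] at this
    rw [← this]
    refine Finset.sum_congr rfl fun r _ => ?_
    have hpow : exp (-(2 * Real.pi * I * ((r : ℕ) : ℤ) * h * ((i : ℕ) : ℤ))) =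
        ((exp (2 * Real.pi * I / N))⁻¹ ^ (r : ℕ)) ^ (i : ℕ) := by
      rw [exp_neg, exp_two_pi_I_eq_zpow hh, ← pow_mul, inv_pow, ← Nat.cast_mul, zpow_natCast]
    rw [hpow, Pi.sub_apply]
    ring

/-- The convolution equation determines the discrete Fourier coefficients. -/
theorem discreteConv_eq_iff {m N : ℕ} (hm : 1 ≤ m) (hN : 1 ≤ N) {h : ℝ} (hh : h = 1 / (N : ℝ))
    {f : ℤ → ℂ} (hf : Summable f) :
    (∀ β : ℤ, (h : ℂ) * discreteConv f (discreteB m h) β = discretePhi h β - (h : ℂ)) ↔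
      ∀ p : ℤ, harrowFourier h f p * periodicWeight m N p = if (N : ℤ) ∣ p then 0 else (h : ℂ) := by
  simp only [mul_discreteConv_eq_sum hm hN hh hf, discretePhi_sub_eq_sum hN hh]
  constructor
  · intro H p
    have hu := eq_of_sum_exp_mul_eq hN hh H
    have hN0 : (0 : ℤ) < N := by omega
    obtain ⟨r, hr⟩ : ∃ r : ℕ, (r : ℤ) = p % N := ⟨(p % N).toNat, Int.toNat_of_nonneg
      (Int.emod_nonneg _ hN0.ne')⟩
    have hrN : r < N := by have := Int.emod_lt_of_pos p hN0; omega
    have hp : p = p / N * N + (r : ℤ) := by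
      rw [hr]
      linarith [Int.emod_add_mul_ediv p N]
    have hdvd : (N : ℤ) ∣ p / N * N + (r : ℤ) ↔ (N : ℤ) ∣ r := by
      rw [Int.dvd_add_right (dvd_mul_left _ _)]
    rw [hp, harrowFourier_add_mul hN hh, periodicWeight_add_mul]
    simp only [hdvd]
    exact congrFun hu ⟨r, hrN⟩
  · intro H β
    exact Finset.sum_congr rfl fun r _ => by rw [H]

theorem exists_eq_inv_mul_iff_dvd {N : ℕ} {h : ℝ} (hh : h = 1 / (N : ℝ)) (p : ℤ) :
    (∃ γ : ℤ, (p : ℝ) = h⁻¹ * γ) ↔ (N : ℤ) ∣ p := by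
  rw [hh, one_div, inv_inv]
  exact exists_congr fun γ => by exact_mod_cast Iff.rfl

/-- The convolution equation holds exactly if the Fourier series of `f` takes at the integers the
values of that of `D_h^{(m)}`. -/
theorem discreteConv_eq_iff_symbolGamma {m N : ℕ} (hm : 1 ≤ m) (hN : 1 ≤ N) {h : ℝ}
    (hh : h = 1 / (N : ℝ)) {f : ℤ → ℂ} (hf : Summable f) :
    (∀ β : ℤ, (h : ℂ) * discreteConv f (discreteB m h) β = discretePhi h β - (h : ℂ)) ↔
      ∀ p : ℤ,
        ((∀ γ : ℤ, (p : ℝ) ≠ h⁻¹ * γ) →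
          harrowFourier h f p = ((h * symbolGamma m h p : ℝ) : ℂ)) ∧
        ((∃ γ : ℤ, (p : ℝ) = h⁻¹ * γ) → harrowFourier h f p = 0) := by
  rw [discreteConv_eq_iff hm hN hh hf]
  refine forall_congr' fun p => ?_
  have hW := periodicWeight_ne_zero hm hN p
  rw [exists_eq_inv_mul_iff_dvd hh, ← not_exists, exists_eq_inv_mul_iff_dvd hh, ofReal_mul,
    symbolGamma_eq_inv_periodicWeight m hh]
  split_ifs with hd
  · simp [hd, hW]
  · simp [hd, eq_mul_inv_iff_mul_eq₀ hW]

end Convolution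

theorem lemma5p1 (m N : ℕ) (hm : 1 ≤ m) (hN : 1 ≤ N) (h : ℝ) (hh : h = 1 / (N : ℝ)) :
    -- the ingredients of `D_h^{(m)}`: exactly `m - 1` inner roots, and nonzero denominators
    ((innerRoots m).card = m - 1 ∧
      ∀ q ∈ innerRoots m, q * (eulerFrobenius (2 * m - 1)).eval q ≠ 0) ∧
    -- `h D * B = Φ - h`, the convolution being absolutely convergent
    (∀ β : ℤ, Summable (fun γ : ℤ => discreteD m h γ * discreteB m h (β - γ)) ∧
      (h : ℂ) * discreteConv (discreteD m h) (discreteB m h) β = discretePhi h β - (h : ℂ)) ∧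
    -- the Fourier transform of the harrow-shaped distribution of `D` is the function `h Γ`
    (∃ T : 𝓢'(ℝ, ℂ), IsHarrow h (discreteD m h) T ∧
      IsGivenBy (𝓕⁻ T) (fun p => ((h * symbolGamma m h p : ℝ) : ℂ))) ∧
    -- the same pointwise, with the value `0` on `h⁻¹ ℤ`
    (Summable (discreteD m h) ∧
      ∀ p : ℝ,
        ((∀ γ : ℤ, p ≠ h⁻¹ * γ) →
          harrowFourier h (discreteD m h) p = ((h * symbolGamma m h p : ℝ) : ℂ)) ∧
        ((∃ γ : ℤ, p = h⁻¹ * γ) → harrowFourier h (discreteD m h) p = 0)) ∧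
    -- for summable `f` the convolution equation is equivalent to the same values at integers `p`
    (∀ f : ℤ → ℂ, Summable f →
      ((∀ β : ℤ, (h : ℂ) * discreteConv f (discreteB m h) β = discretePhi h β - (h : ℂ)) ↔
        ∀ p : ℤ,
          ((∀ γ : ℤ, (p : ℝ) ≠ h⁻¹ * γ) →
            harrowFourier h f p = ((h * symbolGamma m h p : ℝ) : ℂ)) ∧
          ((∃ γ : ℤ, (p : ℝ) = h⁻¹ * γ) → harrowFourier h f p = 0))) := by
  have hN0 : (N : ℝ) ≠ 0 := by exact_mod_cast (show N ≠ 0 by omega)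
  have hh0 : h ≠ 0 := by
    rw [hh]
    exact one_div_ne_zero hN0
  have hD := summable_discreteD hm h
  have hpt : ∀ p : ℝ,
      ((∀ γ : ℤ, p ≠ h⁻¹ * γ) →
        harrowFourier h (discreteD m h) p = ((h * symbolGamma m h p : ℝ) : ℂ)) ∧
      ((∃ γ : ℤ, p = h⁻¹ * γ) → harrowFourier h (discreteD m h) p = 0) := fun p =>
    ⟨harrowFourier_discreteD_eq_symbolGamma hm hh0, harrowFourier_discreteD_eq_zero hm hh0⟩
  refine ⟨⟨card_innerRoots hm, fun q hq => ?_⟩, fun β => ⟨summable_discreteConv hm h hD β, ?_⟩, ?_,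
    ⟨hD, hpt⟩, fun f hf => discreteConv_eq_iff_symbolGamma hm hN hh hf⟩
  · have hq0 := (mem_innerRoots.1 hq).1
    have hsucc := eulerFrobenius.eval_succ_ne_zero hq0
    rw [show 2 * m - 2 + 1 = 2 * m - 1 by omega] at hsucc
    exact mul_ne_zero (eulerFrobenius.ne_zero_of_eval_eq_zero hq0) hsucc
  · exact (discreteConv_eq_iff_symbolGamma hm hN hh hD).2 (fun p => hpt p) β
  · obtain ⟨T, hT⟩ := exists_isHarrow h hD
    refine ⟨T, hT, (hT.isGivenBy_fourierInv hD).congr_ae ?_⟩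
    -- The lattice `h⁻¹ ℤ`, where `symbolGamma` has no meaning, is a null set.
    have hnull : (Set.range fun γ : ℤ => h⁻¹ * (γ : ℝ)).Countable := Set.countable_range _
    filter_upwards [hnull.ae_notMem MeasureTheory.volume] with p hp
    exact (hpt p).1 fun γ hγ => hp ⟨γ, hγ.symm⟩
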